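/- Let $k \ge 1$ and $n \ge 0$ be integers. A $\mathbb{Z}_{2k}$-code of length $n$ is a $\mathbb{Z}_{2k}$-submodule $C$ of $\mathbb{Z}_{2k}^n$; it is self-dual if $C = \{x \in \mathbb{Z}_{2k}^n : x_1y_1+\cdots+x_ny_n = 0 \text{ for all } y \in C\}$. For $a \in \mathbb{Z}_{2k}$ let $\rho(a) \in \{1-k,\ldots,k\}$ be its integer representative, and let $\mathrm{wt}_E(v) = \sum_{i=1}^n \rho(v_i)^2$ be the Euclidean weight of $v \in \mathbb{Z}_{2k}^n$. A Type II $\mathbb{Z}_{2k}$-code is a self-dual code all of whose Euclidean weights are multiples of $4k$; it is called extremal if the smallest Euclidean weight of its nonzero codewords equals $4k\lfloor n/24\rfloor + 4k$ (that is, $8k$ for $n = 32$). The binary part of $C$ is the binary code $C^{(2)} = \{(\rho(c_1) \bmod 2, \ldots, \rho(c_n) \bmod 2) : c \in C\}$. Two codes over the same ring $\mathbb{Z}_m$ are equivalent if one is obtained from the other by permuting the coordinates and (if necessary) changing the signs of certain coordinates. Theorem. For every $k \in \{2,3,\ldots,10\}$ there are five extremal Type II $\mathbb{Z}_{2k}$-codes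 $C_1,\ldots,C_5$ of length $32$ which are pairwise inequivalent and whose binary parts $C_1^{(2)},\ldots,C_5^{(2)}$ are pairwise inequivalent. In particular, there are at least five inequivalent extremal Type II $\mathbb{Z}_{2k}$-codes of length $32$. -/

import Mathlib

namespace ModularCode

/-- A `ℤ_m`-code of length `n`: a `ℤ_m`-submodule of `ℤ_m^n`. -/
abbrev Code (m n : ℕ) : Type := Submodule (ZMod m) (Fin n → ZMod m)

/-- The dual code with respect to the standard inner product `x₁y₁ + ⋯ + xₙyₙ`. -/
def dual {m n : ℕ} (C : Code m n) : Code m n where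
  carrier := {x | ∀ y ∈ C, x ⬝ᵥ y = 0}
  zero_mem' := fun y _ => zero_dotProduct y
  add_mem' := fun {a b} ha hb y hy => by
    rw [add_dotProduct, ha y hy, hb y hy, add_zero]
  smul_mem' := fun c x hx y hy => by
    rw [smul_dotProduct, hx y hy, smul_zero]

/-- A code is self-dual if it equals its dual. -/
def IsSelfDual {m n : ℕ} (C : Code m n) : Prop := C = dual C

/-- Two codes are equivalent if one is obtained from the other by permuting the coordinates
and changing the signs of certain coordinates. -/
def Equivalent {m n : ℕ} (C C' : Code m n) : Prop :=
  ∃ (σ : Equiv.Perm (Fin n)) (ε : Fin n → ℤˣ),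
    (C' : Set (Fin n → ZMod m)) =
      (fun c i => (((ε i : ℤ) : ZMod m)) * c (σ i)) '' (C : Set (Fin n → ZMod m))

/-- The representative of a residue class modulo `2k` in `{1 - k, …, k}` (for `k ≥ 1`). -/
def rho {k : ℕ} (a : ZMod (2 * k)) : ℤ := a.valMinAbs

/-- The Euclidean weight of a vector over `ℤ_{2k}`: the sum of the squares of the
representatives of its coordinates of least absolute value. -/
def euclideanWeight {k n : ℕ} (v : Fin n → ZMod (2 * k)) : ℕ :=
  ∑ i, (rho (v i)).natAbs ^ 2

/-- Type II codes over `ℤ_{2k}`: self-dual, all Euclidean weights divisible by `4k`. -/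
def IsTypeII {k n : ℕ} (C : Code (2 * k) n) : Prop :=
  IsSelfDual C ∧ ∀ c ∈ C, 4 * k ∣ euclideanWeight c

/-- The smallest Euclidean weight among all nonzero codewords
(with value `0` if there is no nonzero codeword). -/
noncomputable def minEuclideanWeight {k n : ℕ} (C : Code (2 * k) n) : ℕ :=
  sInf {w | ∃ c ∈ C, c ≠ 0 ∧ euclideanWeight c = w}

/-- An extremal Type II code over `ℤ_{2k}` of length `n`: a Type II code with
`d_E(C) = 4k ⌊n / 24⌋ + 4k`. -/
def IsExtremalTypeII {k n : ℕ} (C : Code (2 * k) n) : Prop :=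
  IsTypeII C ∧ minEuclideanWeight C = 4 * k * (n / 24) + 4 * k

theorem rho_cast_two {k : ℕ} (a : ZMod (2 * k)) :
    ((rho a : ℤ) : ZMod 2) = ZMod.castHom (Dvd.intro k rfl : 2 ∣ 2 * k) (ZMod 2) a := by
  conv_rhs => rw [← ZMod.coe_valMinAbs a]
  rw [map_intCast]
  rfl

/-- The binary part of a code over `ℤ_{2k}`: all vectors
`(ρ(c₁) mod 2, …, ρ(cₙ) mod 2)` with `c` in the code. -/
def binaryPart {k n : ℕ} (C : Code (2 * k) n) : Code 2 n where
  carrier := {b | ∃ c ∈ C, b = fun i => ((rho (c i) : ℤ) : ZMod 2)}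
  zero_mem' := ⟨0, C.zero_mem, by
    funext i
    rw [rho_cast_two, Pi.zero_apply, Pi.zero_apply, map_zero]⟩
  add_mem' := by
    rintro _ _ ⟨c, hc, rfl⟩ ⟨d, hd, rfl⟩
    refine ⟨c + d, C.add_mem hc hd, ?_⟩
    funext i
    simp only [Pi.add_apply, rho_cast_two, map_add]
  smul_mem' := by
    rintro r _ ⟨c, hc, rfl⟩
    refine ⟨((r.val : ℕ) : ZMod (2 * k)) • c, C.smul_mem _ hc, ?_⟩
    funext i
    rw [Pi.smul_apply, Pi.smul_apply, smul_eq_mul, smul_eq_mul, rho_cast_two, rho_cast_two,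
      map_mul, map_natCast, ZMod.natCast_zmod_val]

end ModularCode

/-!
The codes come from `2k`-frames (32 pairwise orthogonal vectors of norm `2k`) in even unimodular
lattices of dimension 32 without vectors of norm two: for such a frame `f₁, …, f₃₂` of `L`, the
vectors of inner products `(f₁ ⬝ w, …, f₃₂ ⬝ w)` modulo `2k`, for `w ∈ L`, form a self-dual code,
and a codeword of Euclidean weight `e` comes from a lattice vector of norm `e / 2k`. Hence all
weights are multiples of `4k`, and those of nonzero codewords are at least `8k`.

The lattices are built from skew Hadamard matrices `H` of order 32. Up to the scale factor `1 / √8`,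
`lattice H` consists of the integer vectors `z` with coordinates of equal parity and `H z ≡ 0`
modulo `8`. Since `H + Hᵀ = 2`, one has `z ⬝ H z = z ⬝ z`, which makes the lattice even
(`IsSkewHadamard.sixteen_dvd_norm`), and it contains its dual because the rows of `H` belong to it
(`IsSkewHadamard.mem_lattice_of_forall_dvd`). It has no vectors of norm two if no four columns of
`H` satisfy a parity condition (`IsSkewHadamard.norm_ge`), which is a finite check.

The matrices are chosen such that `P Hᵀ + H Pᵀ = 2` holds not only for `P = 1`, but also for two
signed permutation matrices `P`, the left multiplications by the quaternion units `i` and `j`. Then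
the rows of `F = H + 4 (t₀ + t₁ i + t₂ j)` are pairwise orthogonal, their norm depends only on the
integers `t₀`, `t₁`, `t₂`, and suitable values of these give frames for all `k` from `2` to `10`
(`isFrame_frameMatrix`, `exists_coefficients`).

As `F ≡ H` modulo `4`, the words of weight four of the binary part depend only on `H`: they are the
sets of four rows of `H` with the same parity condition
(`IsFrame.indicator_mem_binaryPart_iff`). Their number is invariant under equivalence, and for the
five matrices it is `0, 3, 5, 11, 22`. Equivalent codes have equivalent binary parts, so the codes
themselves are inequivalent as well.
-/

namespace SkewHadamard

open Matrix Finset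

/-! ### The lattice of a skew Hadamard matrix -/

/-- A skew Hadamard matrix of order `32`: a matrix `H` with entries `±1` such that `H - 1` is
skew-symmetric and the rows of `H` are pairwise orthogonal. -/
structure IsSkewHadamard (H : Matrix (Fin 32) (Fin 32) ℤ) : Prop where
  entry : ∀ i j, H i j = 1 ∨ H i j = -1
  skew : ∀ i j, H i j + H j i = if i = j then 2 else 0
  orth : H * Hᵀ = (32 : ℤ) • 1

/-- The integer vectors `z` all of whose coordinates have the same parity and for which all
coordinates of `H z` are divisible by `8`. Scaled by `1 / √8`, they form a lattice. -/
def lattice (H : Matrix (Fin 32) (Fin 32) ℤ) : AddSubgroup (Fin 32 → ℤ) where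
  carrier := {z | (∀ x y, (2 : ℤ) ∣ z x - z y) ∧ ∀ i, (8 : ℤ) ∣ (H *ᵥ z) i}
  zero_mem' := ⟨by simp, by simp⟩
  add_mem' := by
    rintro a b ⟨ha, ha'⟩ ⟨hb, hb'⟩
    refine ⟨fun x y => ?_, fun i => ?_⟩
    · have := dvd_add (ha x y) (hb x y)
      rwa [sub_add_sub_comm] at this
    · rw [mulVec_add]
      exact dvd_add (ha' i) (hb' i)
  neg_mem' := by
    rintro a ⟨ha, ha'⟩
    refine ⟨fun x y => ?_, fun i => ?_⟩
    · have := (ha x y).neg_right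
      rwa [neg_sub, ← neg_sub_neg] at this
    · rw [mulVec_neg]
      exact (ha' i).neg_right

/-- The sets `S` of four columns of `H` whose row sums `∑ x ∈ S, H i x` are all congruent
modulo `4`. For a matrix with entries `±1` these are the words of weight four orthogonal modulo
`2` to all differences of rows of `(1 - H) / 2`. -/
def fourSets (H : Matrix (Fin 32) (Fin 32) ℤ) : Finset (Finset (Fin 32)) :=
  {S ∈ powersetCard 4 univ | ∀ i j, (4 : ℤ) ∣ ∑ x ∈ S, H i x - ∑ x ∈ S, H j x}

variable {H : Matrix (Fin 32) (Fin 32) ℤ} {z w : Fin 32 → ℤ}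

theorem two_dvd_dotProduct_self_sub_sum (y : Fin 32 → ℤ) : (2 : ℤ) ∣ y ⬝ᵥ y - ∑ x, y x := by
  rw [dotProduct, ← sum_sub_distrib]
  refine dvd_sum fun x _ => ?_
  rcases Int.even_or_odd' (y x) with ⟨c, hc | hc⟩ <;> rw [hc]
  · exact ⟨2 * c * c - c, by ring⟩
  · exact ⟨2 * c * c + c, by ring⟩

theorem exists_eq_smul {a : ℤ} {y : Fin 32 → ℤ} (h : ∀ x, a ∣ y x) :
    ∃ x : Fin 32 → ℤ, y = a • x := by
  choose x hx using h
  exact ⟨x, funext fun i => by simpa using hx i⟩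

namespace IsSkewHadamard

theorem odd_entry (hH : IsSkewHadamard H) (i j : Fin 32) : ∃ c, H i j = 2 * c + 1 := by
  rcases hH.entry i j with h | h
  · exact ⟨0, by simp [h]⟩
  · exact ⟨-1, by simp [h]⟩

theorem add_transpose_mulVec (hH : IsSkewHadamard H) (z : Fin 32 → ℤ) :
    H *ᵥ z + Hᵀ *ᵥ z = (2 : ℤ) • z := by
  have : H + Hᵀ = (2 : ℤ) • 1 := by
    ext i j
    simp [hH.skew i j, Matrix.one_apply]
  rw [← add_mulVec, this, smul_mulVec, one_mulVec]

theorem dotProduct_mulVec_self (hH : IsSkewHadamard H) (z : Fin 32 → ℤ) : z ⬝ᵥ H *ᵥ z = z ⬝ᵥ z := by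
  have h := congrArg (z ⬝ᵥ ·) (hH.add_transpose_mulVec z)
  simp only [dotProduct_add, dotProduct_smul, smul_eq_mul] at h
  have h2 : z ⬝ᵥ Hᵀ *ᵥ z = z ⬝ᵥ H *ᵥ z := by
    rw [mulVec_transpose, dotProduct_comm, ← dotProduct_mulVec]
  omega

end IsSkewHadamard

/-- A scaled orthogonal integer matrix is also scaled orthogonal for its columns. -/
theorem transpose_mul_self_of_mul_transpose {F : Matrix (Fin 32) (Fin 32) ℤ} {a : ℤ} (ha : a ≠ 0)
    (h : F * Fᵀ = a • 1) : Fᵀ * F = a • 1 := by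
  have h1 : F.map (Int.cast : ℤ → ℚ) * ((a : ℚ)⁻¹ • (Fᵀ.map (Int.cast : ℤ → ℚ))) = 1 := by
    have h3 : F.map (Int.cast : ℤ → ℚ) * Fᵀ.map (Int.cast : ℤ → ℚ) = (a : ℚ) • 1 := by
      have h4 := Matrix.map_mul (L := F) (M := Fᵀ) (f := Int.castRingHom ℚ)
      have h5 : (F * Fᵀ).map (Int.castRingHom ℚ) = (a : ℚ) • 1 := by
        rw [h]
        ext i j
        simp only [Matrix.map_apply, Matrix.smul_apply, Matrix.one_apply, smul_eq_mul]
        split_ifs <;> simp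
      rw [h5] at h4
      exact h4.symm
    rw [Matrix.mul_smul, h3, smul_smul, inv_mul_cancel₀ (by exact_mod_cast ha), one_smul]
  have h2 := mul_eq_one_comm.mp h1
  ext i j
  have h3 := congrFun (congrFun h2 i) j
  rw [Matrix.smul_mul, Matrix.smul_apply, smul_eq_mul, inv_mul_eq_iff_eq_mul₀
    (by exact_mod_cast ha)] at h3
  have h4 : (((Fᵀ * F) i j : ℤ) : ℚ) = a * (1 : Matrix (Fin 32) (Fin 32) ℚ) i j := by
    rw [← h3]
    simp [Matrix.mul_apply]
  by_cases hij : i = j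
  · subst hij
    simp only [Matrix.one_apply_eq, mul_one] at h4
    simp only [Matrix.smul_apply, Matrix.one_apply_eq, smul_eq_mul, mul_one]
    exact_mod_cast h4
  · simp only [Matrix.one_apply_ne hij, mul_zero] at h4
    simp only [Matrix.smul_apply, Matrix.one_apply_ne hij, smul_eq_mul, mul_zero]
    exact_mod_cast h4

namespace IsSkewHadamard

/-- The norms `z ⬝ᵥ z / 8` of the lattice are even. With `H z = 8 v`, skewness gives
`z ⬝ᵥ z = z ⬝ᵥ H z = 8 (z ⬝ᵥ v)`, and `z ⬝ᵥ v` is even: if the coordinates of `z` are odd, then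
`z ⬝ᵥ v` has the parity of `∑ v`, which is even because `4 z = Hᵀ v`. -/
theorem sixteen_dvd_norm (hH : IsSkewHadamard H) (hz : z ∈ lattice H) : (16 : ℤ) ∣ z ⬝ᵥ z := by
  obtain ⟨hp, h8⟩ := hz
  obtain ⟨v, hv⟩ := exists_eq_smul h8
  have h1 : z ⬝ᵥ z = 8 * (z ⬝ᵥ v) := by
    rw [← hH.dotProduct_mulVec_self z, hv, dotProduct_smul, smul_eq_mul]
  suffices h2 : (2 : ℤ) ∣ z ⬝ᵥ v by
    obtain ⟨c, hc⟩ := h2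
    exact ⟨c, by rw [h1, hc]; ring⟩
  have h3 : (2 : ℤ) ∣ z ⬝ᵥ v - z 0 * ∑ i, v i := by
    rw [dotProduct, mul_sum, ← sum_sub_distrib]
    refine dvd_sum fun i _ => ?_
    rw [← sub_mul]
    exact (hp i 0).mul_right _
  have h4 : (2 : ℤ) ∣ ∑ i, v i := by
    have h5 : Hᵀ *ᵥ v = (4 : ℤ) • z := by
      have h6 : Hᵀ *ᵥ (H *ᵥ z) = (32 : ℤ) • z := by
        rw [mulVec_mulVec, transpose_mul_self_of_mul_transpose (by norm_num) hH.orth,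
          smul_mulVec, one_mulVec]
      rw [hv, mulVec_smul] at h6
      funext i
      have h7 := congrFun h6 i
      simp only [Pi.smul_apply, smul_eq_mul] at h7 ⊢
      omega
    have h6 : (2 : ℤ) ∣ (Hᵀ *ᵥ v) 0 - ∑ i, v i := by
      rw [mulVec, dotProduct, ← sum_sub_distrib]
      refine dvd_sum fun i _ => ?_
      obtain ⟨c, hc⟩ := hH.odd_entry i 0
      rw [transpose_apply, hc]
      exact ⟨c * v i, by ring⟩
    rw [h5, Pi.smul_apply, smul_eq_mul] at h6
    omega
  exact (dvd_sub_left (h4.mul_left _)).mp h3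

theorem eight_dvd_dotProduct (hH : IsSkewHadamard H) (hz : z ∈ lattice H) (hw : w ∈ lattice H) :
    (8 : ℤ) ∣ z ⬝ᵥ w := by
  have h1 := hH.sixteen_dvd_norm (add_mem hz hw)
  have h2 := hH.sixteen_dvd_norm hz
  have h3 := hH.sixteen_dvd_norm hw
  rw [add_dotProduct, dotProduct_add, dotProduct_add, dotProduct_comm w z] at h1
  omega

theorem single_mem (x : Fin 32) : Pi.single x 8 ∈ lattice H := by
  refine ⟨fun a b => ?_, fun i => ?_⟩
  · by_cases ha : a = x <;> by_cases hb : b = x <;>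
      simp [ha, hb]
  · rw [mulVec_single]
    exact ⟨H i x, by simp [mul_comm]⟩

theorem single_add_single_mem (hH : IsSkewHadamard H) (x y : Fin 32) :
    Pi.single x 4 + Pi.single y 4 ∈ lattice H := by
  refine ⟨fun a b => ?_, fun i => ?_⟩
  · simp only [Pi.add_apply, Pi.single_apply]
    split_ifs <;> decide
  · obtain ⟨c, hc⟩ := hH.odd_entry i x
    obtain ⟨d, hd⟩ := hH.odd_entry i y
    refine ⟨c + d + 1, ?_⟩
    rw [mulVec_add, mulVec_single, mulVec_single]
    simp [hc, hd]
    ring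

theorem row_mem (hH : IsSkewHadamard H) (i : Fin 32) : H i ∈ lattice H := by
  refine ⟨fun a b => ?_, fun j => ?_⟩
  · obtain ⟨c, hc⟩ := hH.odd_entry i a
    obtain ⟨d, hd⟩ := hH.odd_entry i b
    exact ⟨c - d, by rw [hc, hd]; ring⟩
  · have h := congrFun (congrFun hH.orth j) i
    have h2 : (H *ᵥ H i) j = (H * Hᵀ) j i := rfl
    rw [h2, h, Matrix.smul_apply, smul_eq_mul]
    exact Dvd.dvd.mul_right (by norm_num) _

/-- The lattice contains its dual: the conditions that define it are inner products with
vectors of the lattice itself. -/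
theorem mem_lattice_of_forall_dvd (hH : IsSkewHadamard H)
    (h : ∀ w ∈ lattice H, (8 : ℤ) ∣ z ⬝ᵥ w) : z ∈ lattice H := by
  refine ⟨fun x y => ?_, fun i => ?_⟩
  · have := h _ (hH.single_add_single_mem x y)
    rw [dotProduct_add, dotProduct_single, dotProduct_single] at this
    omega
  · have := h _ (hH.row_mem i)
    rwa [dotProduct_comm] at this

/-- A vector of norm four whose image under `H` vanishes modulo `4` is supported on four columns
that belong to `fourSets H`. -/
theorem fourSets_nonempty_of_norm_eq_four (hH : IsSkewHadamard H) {x : Fin 32 → ℤ} (hx : x ⬝ᵥ x = 4)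
    (h4 : ∀ i, (4 : ℤ) ∣ (H *ᵥ x) i) : (fourSets H).Nonempty := by
  have hle : ∀ s : Finset (Fin 32), ∑ i ∈ s, x i * x i ≤ 4 := fun s => by
    rw [← hx, dotProduct]
    exact sum_le_sum_of_subset_of_nonneg (subset_univ _) fun i _ _ => mul_self_nonneg _
  -- `x` is not even: otherwise `x = 2 y` with `y ⬝ᵥ y = 1`, and `H y` would be odd.
  have hodd : ∃ a, ¬ (2 : ℤ) ∣ x a := by
    by_contra! hev
    obtain ⟨y, rfl⟩ := exists_eq_smul hev
    have h1 : y ⬝ᵥ y = 1 := by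
      rw [smul_dotProduct, dotProduct_smul, smul_eq_mul, smul_eq_mul] at hx
      omega
    have h2 := two_dvd_dotProduct_self_sub_sum y
    have h3 : (2 : ℤ) ∣ (H *ᵥ y) 0 - ∑ i, y i := by
      rw [mulVec, dotProduct, ← sum_sub_distrib]
      refine dvd_sum fun i _ => ?_
      obtain ⟨c, hc⟩ := hH.odd_entry 0 i
      rw [hc]
      exact ⟨c * y i, by ring⟩
    have h5 := h4 0
    rw [mulVec_smul, Pi.smul_apply, smul_eq_mul] at h5
    omega
  obtain ⟨a, ha⟩ := hodd
  have hsmall : ∀ b, x b = 0 ∨ x b = 1 ∨ x b = -1 := by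
    intro b
    by_cases hb : (2 : ℤ) ∣ x b
    · have hab : a ≠ b := fun h => ha (h ▸ hb)
      have h1 := hle {a, b}
      rw [sum_pair hab] at h1
      obtain ⟨c, hc⟩ := hb
      have h2 : 0 < x a * x a := by
        exact mul_self_pos.mpr fun h => ha (h ▸ dvd_zero _)
      have h3 : c = 0 := by
        by_contra h0
        have : 0 < c * c := mul_self_pos.mpr h0
        rw [hc] at h1
        nlinarith
      left
      rw [hc, h3, mul_zero]
    · have h1 := hle {b}
      rw [sum_singleton] at h1
      have h2 : x b ≤ 2 := by nlinarith
      have h3 : -2 ≤ x b := by nlinarith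
      omega
  set S : Finset (Fin 32) := {b | x b ≠ 0} with hS
  have hcard : S.card = 4 := by
    have h1 : (S.card : ℤ) = x ⬝ᵥ x := by
      rw [hS, card_filter, dotProduct]
      push_cast
      refine sum_congr rfl fun b _ => ?_
      rcases hsmall b with h | h | h <;> simp [h]
    rw [hx] at h1
    exact_mod_cast h1
  refine ⟨S, mem_filter.mpr ⟨mem_powersetCard.mpr ⟨subset_univ _, hcard⟩, ?_⟩⟩
  -- Each row sum over `S` is congruent to `2 N` modulo `4`, `N` the number of entries `-1` of `x`.
  have key : ∀ i, (4 : ℤ) ∣ ∑ b ∈ S, H i b - (H *ᵥ x) i - 2 * ∑ b, (if x b = -1 then 1 else 0) := by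
    intro i
    rw [hS, sum_filter, mulVec, dotProduct, mul_sum, ← sum_sub_distrib, ← sum_sub_distrib]
    refine dvd_sum fun b _ => ?_
    obtain ⟨c, hc⟩ := hH.odd_entry i b
    rcases hsmall b with h | h | h
    · simp [h]
    · simp [h]
    · simp only [h, hc]
      exact ⟨c, by norm_num; ring⟩
  intro i j
  have h1 := key i
  have h2 := key j
  have h3 := h4 i
  have h5 := h4 j
  omega

/-- The minimal norm of the lattice is at least four (that is, `z ⬝ᵥ z ≥ 4 * 8`). -/
theorem norm_ge (hH : IsSkewHadamard H) (h0 : fourSets H = ∅) (hz : z ∈ lattice H)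
    (hne : z ≠ 0) : 32 ≤ z ⬝ᵥ z := by
  have h16 := hH.sixteen_dvd_norm hz
  have hpos : 0 < z ⬝ᵥ z := by
    obtain ⟨a, ha⟩ := Function.ne_iff.mp hne
    have ha' : z a ≠ 0 := ha
    have : z a * z a ≤ z ⬝ᵥ z :=
      single_le_sum (f := fun i => z i * z i) (fun i _ => mul_self_nonneg _) (mem_univ a)
    have : 0 < z a * z a := mul_self_pos.mpr ha'
    omega
  suffices z ⬝ᵥ z ≠ 16 by omega
  intro h
  obtain ⟨hp, h8⟩ := hz
  by_cases hev : (2 : ℤ) ∣ z 0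
  · obtain ⟨x, rfl⟩ := exists_eq_smul (a := 2) fun i => (dvd_sub_left hev).mp (hp i 0)
    rw [smul_dotProduct, dotProduct_smul, smul_eq_mul, smul_eq_mul] at h
    have hne' := hH.fourSets_nonempty_of_norm_eq_four (x := x) (by omega) fun i => by
      have := h8 i
      rw [mulVec_smul, Pi.smul_apply, smul_eq_mul] at this
      omega
    rw [h0] at hne'
    exact not_nonempty_empty hne'
  · have : ∑ _i : Fin 32, (1 : ℤ) ≤ z ⬝ᵥ z := sum_le_sum fun i _ => by
      have h1 : z i ≠ 0 := fun h1 => hev (by have := hp i 0; rw [h1] at this; omega)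
      have : 0 < z i * z i := mul_self_pos.mpr h1
      omega
    simp at this
    omega

end IsSkewHadamard

/-! ### Codes from frames -/

/-- A `2k`-frame of the lattice of `H` (32 pairwise orthogonal vectors of norm `16k / 8 = 2k`),
written as the rows of a matrix `F`, that reduces to `H` modulo `4`. -/
structure IsFrame (k : ℕ) (H F : Matrix (Fin 32) (Fin 32) ℤ) : Prop where
  orth : F * Fᵀ = (16 * k : ℤ) • 1
  row_mem : ∀ i, F i ∈ lattice H
  congr : ∀ i x, (4 : ℤ) ∣ F i x - H i x

/-- The code over `ℤ_{2k}` of a frame `F`: the residues modulo `2k` of the inner products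
`F w / 8` of the lattice vectors `w` with the frame. -/
def frameCode (k : ℕ) (H F : Matrix (Fin 32) (Fin 32) ℤ) : ModularCode.Code (2 * k) 32 where
  carrier := {c | ∃ w ∈ lattice H, ∃ v : Fin 32 → ℤ, F *ᵥ w = (8 : ℤ) • v ∧
    c = fun i => (v i : ZMod (2 * k))}
  zero_mem' := ⟨0, zero_mem _, 0, by simp, by funext i; simp⟩
  add_mem' := by
    rintro _ _ ⟨w, hw, v, hv, rfl⟩ ⟨w', hw', v', hv', rfl⟩
    exact ⟨w + w', add_mem hw hw', v + v', by rw [mulVec_add, hv, hv', smul_add],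
      by funext i; simp⟩
  smul_mem' := by
    rintro r _ ⟨w, hw, v, hv, rfl⟩
    obtain ⟨a, rfl⟩ := ZMod.intCast_surjective r
    exact ⟨a • w, zsmul_mem hw a, a • v, by rw [mulVec_smul, hv, smul_comm],
      by funext i; simp⟩

variable {k : ℕ} {F : Matrix (Fin 32) (Fin 32) ℤ}

theorem smul_vec_cancel {a : ℤ} (ha : a ≠ 0) {x y : Fin 32 → ℤ} (h : a • x = a • y) : x = y :=
  smul_right_injective _ ha h

namespace IsFrame

theorem mulVec_transpose_mulVec (hF : IsFrame k H F) (u : Fin 32 → ℤ) :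
    F *ᵥ (Fᵀ *ᵥ u) = (16 * k : ℤ) • u := by
  rw [mulVec_mulVec, hF.orth, smul_mulVec, one_mulVec]

theorem transpose_mulVec_mulVec (hF : IsFrame k H F) (hk : k ≠ 0) (w : Fin 32 → ℤ) :
    Fᵀ *ᵥ (F *ᵥ w) = (16 * k : ℤ) • w := by
  rw [mulVec_mulVec, transpose_mul_self_of_mul_transpose (by positivity) hF.orth,
    smul_mulVec, one_mulVec]

theorem mulVec_dotProduct_mulVec (hF : IsFrame k H F) (hk : k ≠ 0) (w w' : Fin 32 → ℤ) :
    F *ᵥ w ⬝ᵥ F *ᵥ w' = 16 * k * (w ⬝ᵥ w') := by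
  rw [dotProduct_mulVec, ← mulVec_transpose, hF.transpose_mulVec_mulVec hk, smul_dotProduct,
    smul_eq_mul]

theorem transpose_mulVec_mem (hF : IsFrame k H F) (t : Fin 32 → ℤ) :
    Fᵀ *ᵥ t ∈ lattice H := by
  have : Fᵀ *ᵥ t = ∑ i, t i • F i := by
    funext x
    simp [mulVec, dotProduct, mul_comm]
  rw [this]
  exact sum_mem fun i _ => zsmul_mem (hF.row_mem i) _

/-- Every integer lift of a codeword consists of the inner products with the frame of some
lattice vector: a change of the lift by `2k t` is absorbed by the lattice vector `Fᵀ t`. -/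
theorem exists_of_mem (hF : IsFrame k H F) {c : Fin 32 → ZMod (2 * k)}
    (hc : c ∈ frameCode k H F) {u : Fin 32 → ℤ} (hu : ∀ i, (u i : ZMod (2 * k)) = c i) :
    ∃ w ∈ lattice H, F *ᵥ w = (8 : ℤ) • u := by
  obtain ⟨w, hw, v, hv, rfl⟩ := hc
  have h1 : ∀ i, ((2 * k : ℕ) : ℤ) ∣ u i - v i := fun i =>
    (ZMod.intCast_eq_intCast_iff_dvd_sub _ _ _).mp (hu i).symm
  choose t ht using h1
  refine ⟨w + Fᵀ *ᵥ t, add_mem hw (hF.transpose_mulVec_mem t), ?_⟩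
  rw [mulVec_add, hv, hF.mulVec_transpose_mulVec]
  funext i
  have := ht i
  push_cast at this
  simp only [Pi.add_apply, Pi.smul_apply, smul_eq_mul]
  linear_combination -8 * this

theorem exists_mulVec_eq (hH : IsSkewHadamard H) (hF : IsFrame k H F) {w : Fin 32 → ℤ}
    (hw : w ∈ lattice H) : ∃ v : Fin 32 → ℤ, F *ᵥ w = (8 : ℤ) • v :=
  exists_eq_smul fun i => hH.eight_dvd_dotProduct (hF.row_mem i) hw

theorem isSelfDual (hH : IsSkewHadamard H) (hF : IsFrame k H F) (hk : k ≠ 0) :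
    ModularCode.IsSelfDual (frameCode k H F) := by
  have hk' : (k : ℤ) ≠ 0 := by exact_mod_cast hk
  apply le_antisymm
  · rintro _ ⟨w, hw, v, hv, rfl⟩ _ ⟨w', hw', v', hv', rfl⟩
    obtain ⟨m, hm⟩ := hH.eight_dvd_dotProduct hw hw'
    have h1 := hF.mulVec_dotProduct_mulVec hk w w'
    rw [hv, hv', smul_dotProduct, dotProduct_smul, smul_eq_mul, smul_eq_mul, hm] at h1
    have h2 : v ⬝ᵥ v' = ((2 * k : ℕ) : ℤ) * m := by
      push_cast
      linarith
    have h3 : ((v ⬝ᵥ v' : ℤ) : ZMod (2 * k)) = 0 := by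
      rw [h2, Int.cast_mul, Int.cast_natCast, ZMod.natCast_self, zero_mul]
    simpa [dotProduct] using h3
  · intro c hc
    choose u hu using fun i => ZMod.intCast_surjective (c i)
    have key : ∀ w ∈ lattice H, (16 * k : ℤ) ∣ Fᵀ *ᵥ u ⬝ᵥ w := by
      intro w hw
      obtain ⟨v, hv⟩ := hF.exists_mulVec_eq hH hw
      have h1 : ((u ⬝ᵥ v : ℤ) : ZMod (2 * k)) = 0 := by
        have := hc _ ⟨w, hw, v, hv, rfl⟩
        simpa [dotProduct, hu] using this
      obtain ⟨m, hm⟩ := (ZMod.intCast_zmod_eq_zero_iff_dvd _ _).mp h1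
      refine ⟨m, ?_⟩
      rw [mulVec_transpose, ← dotProduct_mulVec, hv, dotProduct_smul, hm, smul_eq_mul]
      push_cast
      ring
    -- Testing with `w = 8 e_x` shows that `Fᵀ u` is divisible by `2k`.
    obtain ⟨y, hy⟩ : ∃ y : Fin 32 → ℤ, Fᵀ *ᵥ u = (2 * k : ℤ) • y := exists_eq_smul fun x => by
      obtain ⟨m, hm⟩ := key _ (IsSkewHadamard.single_mem x)
      rw [dotProduct_single] at hm
      exact ⟨m, by linarith⟩
    have hyL : y ∈ lattice H := hH.mem_lattice_of_forall_dvd fun w hw => by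
      obtain ⟨m, hm⟩ := key w hw
      rw [hy, smul_dotProduct, smul_eq_mul] at hm
      exact ⟨m, mul_left_cancel₀ (mul_ne_zero two_ne_zero hk') (by linarith)⟩
    refine ⟨y, hyL, u, ?_, funext fun i => (hu i).symm⟩
    have h1 := hF.mulVec_transpose_mulVec u
    rw [hy, mulVec_smul] at h1
    refine smul_vec_cancel (mul_ne_zero two_ne_zero hk') (h1.trans ?_)
    rw [smul_smul]
    congr 1
    ring

theorem norm_eq (hF : IsFrame k H F) (hk : k ≠ 0) {w v : Fin 32 → ℤ}
    (hv : F *ᵥ w = (8 : ℤ) • v) : 4 * (v ⬝ᵥ v) = k * (w ⬝ᵥ w) := by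
  have h1 := hF.mulVec_dotProduct_mulVec hk w w
  rw [hv, smul_dotProduct, dotProduct_smul, smul_eq_mul, smul_eq_mul] at h1
  linarith

theorem euclideanWeight_eq (c : Fin 32 → ZMod (2 * k)) :
    ((ModularCode.euclideanWeight c : ℕ) : ℤ) =
      (fun i => ModularCode.rho (c i)) ⬝ᵥ (fun i => ModularCode.rho (c i)) := by
  rw [ModularCode.euclideanWeight, dotProduct, Nat.cast_sum]
  refine sum_congr rfl fun i _ => ?_
  rw [Nat.cast_pow, Int.natCast_natAbs, sq_abs, sq]

/-- The Euclidean weight of a codeword is `k / 4` times the norm of a lattice vector. -/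
theorem exists_euclideanWeight (hF : IsFrame k H F) (hk : k ≠ 0) {c : Fin 32 → ZMod (2 * k)}
    (hc : c ∈ frameCode k H F) : ∃ w ∈ lattice H,
      4 * ((ModularCode.euclideanWeight c : ℕ) : ℤ) = k * (w ⬝ᵥ w) ∧ (w = 0 → c = 0) := by
  obtain ⟨w, hw, h⟩ := hF.exists_of_mem hc (u := fun i => ModularCode.rho (c i))
    fun i => ZMod.coe_valMinAbs _
  refine ⟨w, hw, by rw [euclideanWeight_eq, hF.norm_eq hk h], ?_⟩
  rintro rfl
  funext i
  have h1 := congrFun h i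
  have h2 : ModularCode.rho (c i) = 0 := by simpa using h1
  rw [← ZMod.coe_valMinAbs (c i)]
  exact (congrArg _ h2).trans Int.cast_zero

theorem isTypeII (hH : IsSkewHadamard H) (hF : IsFrame k H F) (hk : k ≠ 0) :
    ModularCode.IsTypeII (frameCode k H F) := by
  refine ⟨hF.isSelfDual hH hk, fun c hc => ?_⟩
  obtain ⟨w, hw, h, -⟩ := hF.exists_euclideanWeight hk hc
  obtain ⟨m, hm⟩ := hH.sixteen_dvd_norm hw
  rw [hm] at h
  have : ((4 * k : ℕ) : ℤ) ∣ (ModularCode.euclideanWeight c : ℕ) := ⟨m, by push_cast; linarith⟩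
  exact_mod_cast this

/-- The frame reduces to `H` modulo `4`, hence the inner product of a frame vector with
`4 (e_x + e_y)`, divided by `8`, has the parity of `(H i x + H i y) / 2`. -/
theorem exists_mulVec_single_add_single (hH : IsSkewHadamard H) (hF : IsFrame k H F)
    (x y : Fin 32) : ∃ v : Fin 32 → ℤ, F *ᵥ (Pi.single x 4 + Pi.single y 4) = (8 : ℤ) • v ∧
      ∀ i, (4 : ℤ) ∣ 2 * v i - (H i x + H i y) := by
  obtain ⟨v, hv⟩ := hF.exists_mulVec_eq hH (hH.single_add_single_mem x y)
  refine ⟨v, hv, fun i => ?_⟩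
  have h := congrFun hv i
  simp only [mulVec_add, mulVec_single, Pi.add_apply, Pi.smul_apply, smul_eq_mul, Matrix.col_apply,
    MulOpposite.smul_eq_mul_unop, MulOpposite.unop_op] at h
  have h1 := hF.congr i x
  have h2 := hF.congr i y
  omega

theorem isExtremalTypeII (hH : IsSkewHadamard H) (h0 : fourSets H = ∅) (hF : IsFrame k H F)
    (hk : k ≠ 0) : ModularCode.IsExtremalTypeII (frameCode k H F) := by
  refine ⟨hF.isTypeII hH hk, ?_⟩
  have hlow : ∀ c ∈ frameCode k H F, c ≠ 0 → 8 * k ≤ ModularCode.euclideanWeight c := by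
    intro c hc hne
    obtain ⟨w, hw, h, hw0⟩ := hF.exists_euclideanWeight hk hc
    have h1 := hH.norm_ge h0 hw fun h => hne (hw0 h)
    have h2 : (k : ℤ) * 32 ≤ k * (w ⬝ᵥ w) := mul_le_mul_of_nonneg_left h1 (by positivity)
    have h3 : ((8 * k : ℕ) : ℤ) ≤ (ModularCode.euclideanWeight c : ℕ) := by
      push_cast
      linarith
    exact_mod_cast h3
  -- The minimum is attained by the codeword of the minimal vector `4 (e_0 + e_1)`.
  obtain ⟨v, hv, hv2⟩ := hF.exists_mulVec_single_add_single hH 0 1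
  have hnorm : v ⬝ᵥ v = 8 * k := by
    have h1 := hF.norm_eq hk hv
    have h2 : (Pi.single 0 4 + Pi.single 1 4 : Fin 32 → ℤ) ⬝ᵥ (Pi.single 0 4 + Pi.single 1 4) =
        32 := by decide
    rw [h2] at h1
    linarith
  set c : Fin 32 → ZMod (2 * k) := fun i => (v i : ZMod (2 * k)) with hc
  have hmem : c ∈ frameCode k H F := ⟨_, hH.single_add_single_mem 0 1, v, hv, rfl⟩
  have hne : c ≠ 0 := by
    obtain ⟨i, hi0, hi1⟩ : ∃ i, H i 0 = 1 ∧ H i 1 = 1 := by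
      have h00 := hH.skew 0 0
      have h11 := hH.skew 1 1
      have h01 := hH.skew 0 1
      simp only [if_true, show (0 : Fin 32) ≠ 1 by decide, if_false] at h00 h11 h01
      rcases hH.entry 0 1 with h | h
      · exact ⟨0, by omega, h⟩
      · exact ⟨1, by omega, by omega⟩
    intro h
    have h1 : ((v i : ℤ) : ZMod (2 * k)) = 0 := congrFun h i
    obtain ⟨m, hm⟩ := (ZMod.intCast_zmod_eq_zero_iff_dvd _ _).mp h1
    have h2 := hv2 i
    rw [hi0, hi1, hm] at h2
    push_cast at h2
    obtain ⟨n, hn⟩ := h2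
    have h3 : (2 : ℤ) * (k * m - n) = 1 := by linarith
    omega
  have hle : ModularCode.euclideanWeight c ≤ 8 * k := by
    have h1 : ((ModularCode.euclideanWeight c : ℕ) : ℤ) ≤ v ⬝ᵥ v := by
      rw [ModularCode.euclideanWeight, dotProduct]
      push_cast
      refine sum_le_sum fun i _ => ?_
      have h2 : (ModularCode.rho (c i)).natAbs ≤ (v i).natAbs := by
        have : NeZero (2 * k) := ⟨by omega⟩
        exact ZMod.natAbs_min_of_le_div_two _ _ _ (by simp [ModularCode.rho, hc])
          (ZMod.natAbs_valMinAbs_le _)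
      have h3 := Int.natAbs_le_iff_sq_le.mp h2
      rw [sq_abs, ← sq]
      exact h3
    rw [hnorm] at h1
    exact_mod_cast h1
  have heq : ModularCode.euclideanWeight c = 8 * k := le_antisymm hle (hlow c hmem hne)
  have hmin : ModularCode.minEuclideanWeight (frameCode k H F) = 8 * k := by
    apply le_antisymm
    · exact Nat.sInf_le ⟨c, hmem, hne, heq⟩
    · refine le_csInf ⟨_, c, hmem, hne, heq⟩ ?_
      rintro _ ⟨d, hd, hd0, rfl⟩
      exact hlow d hd hd0
  rw [hmin]
  omega

/-- The words of weight four of the binary part of a frame code, which do not depend on the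
frame. Such a word is orthogonal to the residues `(H i x - H i y) / 2` of the codewords of
`4 (e_x - e_y)`. Conversely, the set `S`, with one sign changed if necessary, is a vector `x` with
`Hᵀ x` divisible by `4`, so that `H x = 2 x - Hᵀ x` is congruent to `2 x` modulo `4`, and the
codeword of `4 x` reduces to `x` modulo `2`. -/
theorem indicator_mem_binaryPart_iff (hH : IsSkewHadamard H) (hF : IsFrame k H F) (hk : k ≠ 0)
    {S : Finset (Fin 32)} (hS : S.card = 4) :
    (fun i => if i ∈ S then 1 else 0) ∈ ModularCode.binaryPart (frameCode k H F) ↔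
      S ∈ fourSets Hᵀ := by
  constructor
  · rintro ⟨_, ⟨w, hw, v, hv, rfl⟩, hb⟩
    refine mem_filter.mpr ⟨mem_powersetCard.mpr ⟨subset_univ _, hS⟩, fun x y => ?_⟩
    have hvS : ∀ i, (2 : ℤ) ∣ v i - if i ∈ S then 1 else 0 := fun i => by
      have h1 := congrFun hb i
      rw [ModularCode.rho_cast_two, map_intCast] at h1
      have h2 : (((if i ∈ S then 1 else 0 : ℤ)) : ZMod 2) = (v i : ZMod 2) := by
        rw [← h1]
        split_ifs <;> simp
      exact_mod_cast (ZMod.intCast_eq_intCast_iff_dvd_sub _ _ _).mp h2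
    obtain ⟨v', hv', hv2⟩ := hF.exists_mulVec_single_add_single hH x y
    have heven : (2 : ℤ) ∣ v ⬝ᵥ v' := by
      obtain ⟨m, hm⟩ := hH.eight_dvd_dotProduct hw (hH.single_add_single_mem x y)
      have h1 := hF.mulVec_dotProduct_mulVec hk w (Pi.single x 4 + Pi.single y 4)
      rw [hv, hv', smul_dotProduct, dotProduct_smul, smul_eq_mul, smul_eq_mul, hm] at h1
      exact ⟨k * m, by linarith⟩
    have h1 : (2 : ℤ) ∣ ∑ i ∈ S, v' i - v ⬝ᵥ v' := by
      rw [dotProduct, ← sum_filter_add_sum_filter_not univ (· ∈ S) fun i => v i * v' i,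
        filter_mem_eq_inter, univ_inter, ← sub_sub, ← sum_sub_distrib]
      refine dvd_sub (dvd_sum fun i hi => ?_) (dvd_sum fun i hi => ?_)
      · have := hvS i
        rw [if_pos hi] at this
        obtain ⟨n, hn⟩ := this
        exact ⟨-n * v' i, by linear_combination -(v' i) * hn⟩
      · have := hvS i
        rw [if_neg (mem_filter.mp hi).2, sub_zero] at this
        exact this.mul_right _
    have h2 : (4 : ℤ) ∣ 2 * ∑ i ∈ S, v' i - ∑ i ∈ S, (H i x + H i y) := by
      rw [mul_sum, ← sum_sub_distrib]
      exact dvd_sum fun i _ => hv2 i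
    have h3 : (4 : ℤ) ∣ ∑ i ∈ S, (H i x + H i y) - ∑ i ∈ S, (H i x - H i y) - 2 * S.card := by
      rw [← sum_sub_distrib, card_eq_sum_ones]
      push_cast
      rw [mul_sum, ← sum_sub_distrib]
      refine dvd_sum fun i _ => ?_
      obtain ⟨c, hc⟩ := hH.odd_entry i y
      exact ⟨c, by rw [hc]; ring⟩
    rw [hS] at h3
    simp only [transpose_apply]
    rw [← sum_sub_distrib]
    omega
  · intro hmem
    have h4 := (mem_filter.mp hmem).2
    simp only [transpose_apply] at h4
    obtain ⟨a, ha⟩ : S.Nonempty := card_pos.mp (by omega)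
    have hev : ∀ j, (2 : ℤ) ∣ ∑ i ∈ S, H i j := fun j => by
      have : (2 : ℤ) ∣ ∑ i ∈ S, (H i j - 1) := dvd_sum fun i _ => by
        obtain ⟨c, hc⟩ := hH.odd_entry i j
        exact ⟨c, by rw [hc]; ring⟩
      rw [sum_sub_distrib, sum_const, hS] at this
      norm_num at this
      omega
    obtain ⟨x, hx4, hxS⟩ : ∃ x : Fin 32 → ℤ, (∀ j, (4 : ℤ) ∣ (Hᵀ *ᵥ x) j) ∧
        ∀ i, (2 : ℤ) ∣ x i - if i ∈ S then 1 else 0 := by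
      have hind : ∀ j, (Hᵀ *ᵥ fun i => if i ∈ S then 1 else 0) j = ∑ i ∈ S, H i j := fun j => by
        simp [mulVec, dotProduct]
      by_cases h : (4 : ℤ) ∣ ∑ i ∈ S, H i 0
      · refine ⟨fun i => if i ∈ S then 1 else 0, fun j => ?_, fun i => by simp⟩
        rw [hind]
        have := h4 j 0
        omega
      · refine ⟨(fun i => if i ∈ S then 1 else 0) - Pi.single a 2, fun j => ?_, fun i => ?_⟩
        · rw [mulVec_sub, Pi.sub_apply, hind, mulVec_single]
          have h1 := h4 j 0
          have h2 := hev 0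
          obtain ⟨c, hc⟩ := hH.odd_entry a j
          simp [hc]
          omega
        · by_cases hia : i = a <;> simp [hia]
    obtain ⟨r, hr⟩ := exists_eq_smul hx4
    have hHx : H *ᵥ x = (2 : ℤ) • x - (4 : ℤ) • r := by
      rw [← hr, ← hH.add_transpose_mulVec x, add_sub_cancel_right]
    have hwL : (4 : ℤ) • x ∈ lattice H := by
      refine ⟨fun i j => ⟨2 * x i - 2 * x j, by simp; ring⟩, fun i => ⟨x i - 2 * r i, ?_⟩⟩
      rw [mulVec_smul, hHx]
      simp
      ring
    obtain ⟨v, hv⟩ := hF.exists_mulVec_eq hH hwL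
    refine ⟨_, ⟨_, hwL, v, hv, rfl⟩, funext fun i => ?_⟩
    rw [ModularCode.rho_cast_two, map_intCast]
    have h1 : (2 : ℤ) ∣ v i - x i := by
      have h2 : (4 : ℤ) ∣ (F *ᵥ x) i - (H *ᵥ x) i := by
        rw [mulVec, mulVec, dotProduct, dotProduct, ← sum_sub_distrib]
        refine dvd_sum fun j _ => ?_
        rw [← sub_mul]
        exact (hF.congr i j).mul_right _
      have h3 := congrFun hv i
      rw [mulVec_smul] at h3
      rw [hHx] at h2
      simp only [Pi.smul_apply, Pi.sub_apply, smul_eq_mul] at h2 h3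
      omega
    have h2 : (2 : ℤ) ∣ v i - if i ∈ S then 1 else 0 := by
      have := hxS i
      omega
    have h3 := (ZMod.intCast_eq_intCast_iff_dvd_sub _ _ 2).mpr (by exact_mod_cast h2)
    rw [← h3]
    split_ifs <;> simp

end IsFrame

/-! ### Words of weight four as an invariant -/

open ModularCode

/-- The supports of the words of weight four of a binary code. -/
noncomputable def fourWords (B : Code 2 32) : Finset (Finset (Fin 32)) := by
  classical
  exact {S ∈ powersetCard 4 univ | (fun i => if i ∈ S then 1 else 0) ∈ B}

theorem card_fourWords_eq {B B' : Code 2 32} (h : Equivalent B B') :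
    (fourWords B').card = (fourWords B).card := by
  classical
  obtain ⟨σ, ε, hσ⟩ := h
  have hε : ∀ i, (((ε i : ℤ) : ZMod 2)) = 1 := fun i => by
    rcases Int.units_eq_one_or (ε i) with h | h <;> rw [h] <;> decide
  have hmem : ∀ b : Fin 32 → ZMod 2, b ∈ B ↔ (fun i => b (σ i)) ∈ B' := fun b => by
    rw [← SetLike.mem_coe (p := B'), hσ]
    simp only [hε, one_mul]
    constructor
    · exact fun hb => ⟨b, hb, rfl⟩
    · rintro ⟨c, hc, hcb⟩
      have : c = b := funext fun i => by simpa using congrFun hcb (σ.symm i)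
      exact this ▸ hc
  refine card_equiv σ.finsetCongr fun S => ?_
  simp only [fourWords, mem_filter, mem_powersetCard, subset_univ, true_and,
    Equiv.finsetCongr_apply, card_map]
  rw [hmem]
  simp

theorem equivalent_binaryPart {C C' : Code (2 * k) 32} (h : Equivalent C C') :
    Equivalent (binaryPart C) (binaryPart C') := by
  obtain ⟨σ, ε, hσ⟩ := h
  refine ⟨σ, ε, Set.ext fun b => ⟨?_, ?_⟩⟩
  · rintro ⟨c', hc', rfl⟩
    rw [← SetLike.mem_coe, hσ] at hc'
    obtain ⟨c, hc, rfl⟩ := hc'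
    refine ⟨_, ⟨c, hc, rfl⟩, funext fun i => ?_⟩
    simp only [rho_cast_two, map_mul, map_intCast]
  · rintro ⟨_, ⟨c, hc, rfl⟩, rfl⟩
    refine ⟨_, by rw [← SetLike.mem_coe, hσ]; exact ⟨c, hc, rfl⟩, funext fun i => ?_⟩
    simp only [rho_cast_two, map_mul, map_intCast]

theorem IsFrame.card_fourWords (hH : IsSkewHadamard H) (hF : IsFrame k H F) (hk : k ≠ 0) :
    (fourWords (ModularCode.binaryPart (frameCode k H F))).card = (fourSets Hᵀ).card := by
  classical
  congr 1
  ext S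
  simp only [fourWords, mem_filter, mem_powersetCard, subset_univ, true_and]
  constructor
  · rintro ⟨h4, h⟩
    exact (hF.indicator_mem_binaryPart_iff hH hk h4).mp h
  · intro h
    have h4 := (mem_powersetCard.mp (mem_filter.mp h).1).2
    exact ⟨h4, (hF.indicator_mem_binaryPart_iff hH hk h4).mpr h⟩

/-! ### Counting four-sets with bit masks -/

/-- The matrix with entries `±1` whose `i`-th row has its entries `-1` at the positions of the
binary digits `1` of `m i`. -/
def signMatrix (m : Fin 32 → ℕ) : Matrix (Fin 32) (Fin 32) ℤ :=
  fun i x => if (m i).testBit x then -1 else 1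

/-- The sum of `f a l` over all ways to write a list as `_ ++ a :: l`. -/
def sumTails (f : ℕ → List ℕ → ℕ) : List ℕ → ℕ
  | [] => 0
  | a :: l => sumTails f l + f a l

/-- The number of `n`-element sublists of a list for which the bitwise sum of `a` and all
elements of the sublist is constant on the first 32 digits. -/
def countConstant : ℕ → List ℕ → ℕ → ℕ
  | 0, _, a => bif Nat.beq a 0 || Nat.beq a 0xffffffff then 1 else 0
  | n + 1, l, a => sumTails (fun m l => countConstant n l (a ^^^ m)) l

/-- The bitwise sum of `a` and the masks in `S`. -/
def xorSum (m : Fin 32 → ℕ) (a : ℕ) (S : Finset (Fin 32)) : ℕ :=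
  S.fold (· ^^^ ·) a m

variable {m : Fin 32 → ℕ}

theorem xorSum_insert {a : ℕ} {i : Fin 32} {S : Finset (Fin 32)} (hi : i ∉ S) :
    xorSum m a (insert i S) = m i ^^^ xorSum m a S :=
  fold_insert hi

theorem xorSum_xor (a b : ℕ) (S : Finset (Fin 32)) :
    xorSum m (a ^^^ b) S = b ^^^ xorSum m a S := by
  induction S using Finset.induction_on with
  | empty => exact Nat.xor_comm a b
  | insert i S hi ih => rw [xorSum_insert hi, xorSum_insert hi, ih, Nat.xor_left_comm]

theorem card_filter_eq_countConstant (n : ℕ) (l : List (Fin 32)) (hl : l.Nodup) (a : ℕ) :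
    #{S ∈ powersetCard n l.toFinset | xorSum m a S = 0 ∨ xorSum m a S = 0xffffffff} =
      countConstant n (l.map m) a := by
  induction n generalizing l a with
  | zero =>
    rw [powersetCard_zero, filter_singleton, countConstant]
    by_cases h0 : a = 0
    · simp [xorSum, h0]
    · by_cases h1 : a = 0xffffffff
      · simp [xorSum, h1]
      · have h2 : Nat.beq a 0 = false :=
          Bool.eq_false_iff.mpr fun h => h0 (Nat.eq_of_beq_eq_true h)
        have h3 : Nat.beq a 0xffffffff = false :=
          Bool.eq_false_iff.mpr fun h => h1 (Nat.eq_of_beq_eq_true h)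
        simp [xorSum, h0, h1, h2, h3]
  | succ n ihn =>
    induction l with
    | nil => simp [countConstant, sumTails]
    | cons i l ihl =>
      obtain ⟨hi, hl'⟩ := List.nodup_cons.mp hl
      have hi' : i ∉ l.toFinset := by simpa using hi
      have hsucc : countConstant (n + 1) ((i :: l).map m) a =
          countConstant (n + 1) (l.map m) a + countConstant n (l.map m) (a ^^^ m i) := rfl
      have hnot : ∀ S ∈ powersetCard n l.toFinset, i ∉ S := fun S hS h =>
        hi' ((mem_powersetCard.mp hS).1 h)
      rw [hsucc, ← ihl hl', ← ihn l hl', List.toFinset_cons, powersetCard_succ_insert hi',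
        filter_union, card_union_of_disjoint, filter_image, card_image_of_injOn]
      · congr 2
        refine filter_congr fun S hS => ?_
        rw [xorSum_insert (hnot S hS), xorSum_xor]
      · intro S hS T hT h
        have hS' := hnot S (mem_filter.mp hS).1
        have hT' := hnot T (mem_filter.mp hT).1
        rw [← erase_insert hS', ← erase_insert hT']
        exact congrArg (erase · i) h
      · refine disjoint_left.mpr fun S hS hS' => ?_
        obtain ⟨T, -, rfl⟩ := mem_image.mp (mem_filter.mp hS').1
        exact hi' ((mem_powersetCard.mp (mem_filter.mp hS).1).1 (mem_insert_self i T))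

theorem four_dvd_sum_signMatrix (S : Finset (Fin 32)) (x : Fin 32) :
    (4 : ℤ) ∣ ∑ i ∈ S, signMatrix m i x - S.card + if (xorSum m 0 S).testBit x then 2 else 0 := by
  induction S using Finset.induction_on with
  | empty => simp [xorSum]
  | insert i S hi ih =>
    rw [sum_insert hi, card_insert_of_notMem hi, xorSum_insert hi, Nat.testBit_xor, signMatrix]
    push_cast
    cases h1 : (m i).testBit x <;> cases h2 : (xorSum m 0 S).testBit x <;>
      simp only [h2, Bool.xor_false, Bool.xor_true, Bool.not_true, Bool.not_false, if_true,
        Bool.false_eq_true, if_false] at ih ⊢ <;> omega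

theorem xorSum_lt (hm : ∀ i, m i < 2 ^ 32) (S : Finset (Fin 32)) : xorSum m 0 S < 2 ^ 32 := by
  induction S using Finset.induction_on with
  | empty => simp [xorSum]
  | insert i S hi ih =>
    rw [xorSum_insert hi]
    exact Nat.xor_lt_two_pow (hm i) ih

theorem card_fourSets_transpose (hm : ∀ i, m i < 2 ^ 32) :
    #(fourSets (signMatrix m)ᵀ) = countConstant 4 (List.ofFn m) 0 := by
  have h := card_filter_eq_countConstant (m := m) 4 (List.finRange 32) (List.nodup_finRange 32) 0
  rw [List.toFinset_finRange, ← List.ofFn_eq_map] at h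
  rw [← h, fourSets]
  congr 1
  refine filter_congr fun S hS => ?_
  simp only [transpose_apply]
  have hbit : (∀ x y : Fin 32, (4 : ℤ) ∣ ∑ i ∈ S, signMatrix m i x - ∑ i ∈ S, signMatrix m i y) ↔
      ∀ x y : Fin 32, (xorSum m 0 S).testBit x = (xorSum m 0 S).testBit y := by
    refine forall₂_congr fun x y => ?_
    have hx := four_dvd_sum_signMatrix (m := m) S x
    have hy := four_dvd_sum_signMatrix (m := m) S y
    cases h1 : (xorSum m 0 S).testBit x <;> cases h2 : (xorSum m 0 S).testBit y <;>
      simp only [h1, h2, if_true, Bool.false_eq_true, if_false, Bool.true_eq_false, iff_true,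
        iff_false] at hx hy ⊢ <;> omega
  rw [hbit]
  have hlt := xorSum_lt hm S
  have hhigh : ∀ n, 32 ≤ n → (xorSum m 0 S).testBit n = false := fun n hn =>
    Nat.testBit_lt_two_pow (hlt.trans_le (Nat.pow_le_pow_right two_pos hn))
  constructor
  · intro hc
    cases h0 : (xorSum m 0 S).testBit 0
    · left
      refine Nat.eq_of_testBit_eq fun n => ?_
      rw [Nat.zero_testBit]
      by_cases hn : n < 32
      · exact (hc ⟨n, hn⟩ 0).trans h0
      · exact hhigh n (by omega)
    · right
      refine Nat.eq_of_testBit_eq fun n => ?_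
      rw [show (0xffffffff : ℕ) = 2 ^ 32 - 1 by norm_num, Nat.testBit_two_pow_sub_one]
      by_cases hn : n < 32
      · rw [decide_eq_true hn]
        exact (hc ⟨n, hn⟩ 0).trans h0
      · rw [decide_eq_false hn]
        exact hhigh n (by omega)
  · rintro (h | h) x y
    · simp [h]
    · rw [h, show (0xffffffff : ℕ) = 2 ^ 32 - 1 by norm_num, Nat.testBit_two_pow_sub_one,
        Nat.testBit_two_pow_sub_one, decide_eq_true x.2, decide_eq_true y.2]

/-! ### Signed permutation matrices and frames -/

/-- The permutations underlying the left multiplications by `1`, `i` and `j` on `ℍ ^ 8`, where the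
coordinates `4 r, …, 4 r + 3` belong to the basis `1, i, j, k` of the `r`-th factor. -/
def unitPerm : Fin 3 → Fin 32 → Fin 32 :=
  ![fun x => x, fun x => x ^^^ 1, fun x => x ^^^ 2]

/-- The signs of the left multiplications by `1`, `i` and `j`. -/
def unitSign : Fin 3 → Fin 32 → ℤ :=
  ![fun _ => 1, fun x => ![1, -1, 1, -1] (Fin.ofNat 4 x), fun x => ![1, -1, -1, 1] (Fin.ofNat 4 x)]

/-- The signed permutation matrices of the left multiplications by `1`, `i` and `j`. -/
def unitMatrix (p : Fin 3) : Matrix (Fin 32) (Fin 32) ℤ :=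
  fun x y => if y = unitPerm p x then unitSign p x else 0

theorem mul_transpose_unitMatrix (M : Matrix (Fin 32) (Fin 32) ℤ) (p : Fin 3) (i j : Fin 32) :
    (M * (unitMatrix p)ᵀ) i j = M i (unitPerm p j) * unitSign p j := by
  simp [Matrix.mul_apply, unitMatrix]

theorem unitMatrix_orthogonal (p q : Fin 3) :
    unitMatrix p * (unitMatrix q)ᵀ + unitMatrix q * (unitMatrix p)ᵀ =
      (if p = q then 2 else 0 : ℤ) • 1 := by
  have h : ∀ (p q : Fin 3) (i j : Fin 32),
      (if unitPerm q j = unitPerm p i then unitSign p i else 0) * unitSign q j +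
      (if unitPerm p j = unitPerm q i then unitSign q i else 0) * unitSign p j =
        (if p = q then 2 else 0) * if i = j then 1 else 0 := by
    decide +kernel
  ext i j
  rw [Matrix.add_apply, mul_transpose_unitMatrix, mul_transpose_unitMatrix, Matrix.smul_apply,
    Matrix.one_apply, smul_eq_mul, ← h]
  rfl

/-- The orthogonality relations `H Pᵀ + P Hᵀ = 2` between `H` and the left multiplications `P` by
`1`, `i` and `j`, written out in coordinates. -/
def UnitSkew (H : Matrix (Fin 32) (Fin 32) ℤ) : Prop :=
  ∀ (p : Fin 3) (i j : Fin 32), H i (unitPerm p j) * unitSign p j +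
    H j (unitPerm p i) * unitSign p i = if i = j then 2 else 0

/-- The matrix `H + 4 (t₀ + t₁ i + t₂ j)`. -/
def frameMatrix (H : Matrix (Fin 32) (Fin 32) ℤ) (t : Fin 3 → ℤ) : Matrix (Fin 32) (Fin 32) ℤ :=
  H + (4 : ℤ) • ∑ p, t p • unitMatrix p

theorem UnitSkew.mul_transpose_add (hU : UnitSkew H) (p : Fin 3) :
    H * (unitMatrix p)ᵀ + unitMatrix p * Hᵀ = (2 : ℤ) • 1 := by
  ext i j
  have h1 : (unitMatrix p * Hᵀ) i j = (H * (unitMatrix p)ᵀ) j i := by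
    rw [← transpose_apply (H * (unitMatrix p)ᵀ), transpose_mul, transpose_transpose]
  rw [Matrix.add_apply, h1, mul_transpose_unitMatrix, mul_transpose_unitMatrix, hU p i j]
  simp [Matrix.one_apply]

/-- The rows of `H + 4 (t₀ + t₁ i + t₂ j)` have norm
`32 + 8 (t₀ + t₁ + t₂) + 16 (t₀² + t₁² + t₂²)`. -/
theorem frameMatrix_mul_transpose (hH : IsSkewHadamard H) (hU : UnitSkew H) (t : Fin 3 → ℤ) :
    frameMatrix H t * (frameMatrix H t)ᵀ =
      (32 + 8 * ∑ p, t p + 16 * ∑ p, t p ^ 2) • (1 : Matrix (Fin 32) (Fin 32) ℤ) := by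
  set G := ∑ p, t p • unitMatrix p with hG
  have h1 : H * Gᵀ + G * Hᵀ = (2 * ∑ p, t p) • (1 : Matrix (Fin 32) (Fin 32) ℤ) := by
    rw [hG, transpose_sum, mul_sum, sum_mul, ← sum_add_distrib, mul_sum, sum_smul]
    refine sum_congr rfl fun p _ => ?_
    rw [transpose_smul, Matrix.mul_smul, Matrix.smul_mul, ← smul_add,
      hU.mul_transpose_add, smul_smul, mul_comm]
  have h2 : (2 : ℤ) • (G * Gᵀ) = (2 : ℤ) • ((∑ p, t p ^ 2) • 1) := by
    have h3 : G * Gᵀ = ∑ p, ∑ q, (t p * t q) • (unitMatrix p * (unitMatrix q)ᵀ) := by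
      rw [hG, transpose_sum, sum_mul]
      refine sum_congr rfl fun p _ => ?_
      rw [mul_sum]
      refine sum_congr rfl fun q _ => ?_
      rw [transpose_smul, Matrix.mul_smul, Matrix.smul_mul, smul_smul, mul_comm]
    have h4 : G * Gᵀ = ∑ p, ∑ q, (t p * t q) • (unitMatrix q * (unitMatrix p)ᵀ) := by
      rw [h3, sum_comm]
      simp only [mul_comm]
    rw [two_smul]
    nth_rewrite 1 [h3]
    rw [h4, ← sum_add_distrib, sum_smul, smul_sum]
    refine sum_congr rfl fun p _ => ?_
    rw [← sum_add_distrib]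
    simp only [← smul_add, unitMatrix_orthogonal]
    simp only [ite_smul, zero_smul, smul_ite, smul_zero]
    rw [sum_ite_eq, if_pos (mem_univ p), smul_smul, smul_smul]
    congr 1
    ring
  have h3 : G * Gᵀ = (∑ p, t p ^ 2) • (1 : Matrix (Fin 32) (Fin 32) ℤ) :=
    smul_right_injective _ two_ne_zero h2
  have h4 : frameMatrix H t = H + (4 : ℤ) • G := rfl
  rw [h4, transpose_add, transpose_smul, add_mul, mul_add, mul_add, Matrix.mul_smul, Matrix.smul_mul,
    Matrix.smul_mul, Matrix.mul_smul, smul_smul, hH.orth, h3, add_assoc,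
    ← add_assoc ((4 : ℤ) • (H * Gᵀ)), ← smul_add, h1, smul_smul, smul_smul, ← add_smul, ← add_smul]
  congr 1
  ring

theorem isFrame_frameMatrix (hH : IsSkewHadamard H) (hU : UnitSkew H) {k : ℕ} {t : Fin 3 → ℤ}
    (ht : (2 : ℤ) ∣ ∑ p, t p)
    (hk : 32 + 8 * ∑ p, t p + 16 * ∑ p, t p ^ 2 = 16 * k) : IsFrame k H (frameMatrix H t) where
  orth := by rw [frameMatrix_mul_transpose hH hU, hk]
  row_mem i := by
    constructor
    · intro x y
      obtain ⟨c, hc⟩ := hH.odd_entry i x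
      obtain ⟨d, hd⟩ := hH.odd_entry i y
      simp only [frameMatrix, Matrix.add_apply, Matrix.smul_apply, smul_eq_mul, hc, hd]
      omega
    · intro j
      set G := ∑ p, t p • unitMatrix p with hG
      have h1 : (H *ᵥ frameMatrix H t i) j = (H * Hᵀ) j i + 4 * (H * Gᵀ) j i := by
        change (H * (H + (4 : ℤ) • G)ᵀ) j i = _
        rw [transpose_add, transpose_smul, mul_add, Matrix.mul_smul, Matrix.add_apply,
          Matrix.smul_apply, smul_eq_mul]
      have h2 : (2 : ℤ) ∣ (H * Gᵀ) j i - ∑ p, t p := by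
        rw [hG, transpose_sum, mul_sum, Matrix.sum_apply, ← sum_sub_distrib]
        refine dvd_sum fun p _ => ?_
        rw [transpose_smul, Matrix.mul_smul, Matrix.smul_apply, mul_transpose_unitMatrix,
          smul_eq_mul]
        have hs : ∀ (p : Fin 3) (i : Fin 32), unitSign p i = 1 ∨ unitSign p i = -1 := by
          decide +kernel
        obtain ⟨c, hc⟩ := hH.odd_entry j (unitPerm p i)
        rcases hs p i with h | h <;> rw [h, hc]
        · exact ⟨t p * c, by ring⟩
        · exact ⟨-(t p * c) - t p, by ring⟩
      rw [h1, hH.orth, Matrix.smul_apply, smul_eq_mul]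
      omega
  congr i x := ⟨(∑ p, t p • unitMatrix p) i x, by
    simp only [frameMatrix, Matrix.add_apply, Matrix.smul_apply, smul_eq_mul, add_sub_cancel_left]⟩

/-! ### Five skew Hadamard matrices -/

/-- The rows of five skew Hadamard matrices, as bit masks. They have the form `1 + i + j + k T`
where `i`, `j`, `k` act on `ℍ ^ 8` from the left and `T`, acting from the right, is a quaternionic
Hermitian matrix with `T ^ 2 = 29`, diagonal entries `± 1` and all other entries of the form
`± 1 ± i ± j ± k`. -/
def rowList : Fin 5 → List ℕ := ![
  [0x44343348, 0x2292992d, 0x77a7aa71, 0x11f1ff14, 0xdc43b903, 0x4629dc99, 0x157a803a, 0x801fea5f,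
   0x344cf8e4, 0x92265d72, 0xa77591d7, 0xf110c441, 0x092308c4, 0xacb99e62, 0x60ea3457, 0x3a7f5201,
   0x07c84b43, 0xa16d2d29, 0x6b51787a, 0x3d041e1f, 0xe50b5334, 0x709d0992, 0xd3383aa7, 0x495e9ff1,
   0x2820e3b3, 0xbdba79d9, 0xe1e6da8a, 0x74734fef, 0x059774a3, 0x90c112f9, 0x330bb7ca, 0x59add16f],
  [0x34434338, 0x9229299d, 0xa77a7aa1, 0xf11f1ff4, 0x2205fe04, 0xbba05792, 0xee639d37, 0x7739c451,
   0x5c745894, 0x06120dc2, 0x35b73107, 0x90d194a1, 0xec0d0283, 0x76a49be9, 0xd5613e4a, 0x4038572f,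
   0xdf10a324, 0x4589f9b2, 0x1923cae7, 0x8cb56f71, 0xd2067073, 0x4b931a19, 0x1e3fb6ba, 0x8755d3df,
   0x3858bb53, 0x9d0edd09, 0xa134883a, 0xf492ee9f, 0x84aa9254, 0xd2ffcb02, 0x17cc0e37, 0x4166a791],
  [0x33433430, 0x99299299, 0xaa7aa7a3, 0xff1ff1f5, 0x128e8184, 0x8be7e8d2, 0x2e4d4217, 0xb7242b41,
   0xc3990063, 0x69cca939, 0x5a0063fa, 0x0faa355f, 0x29b507f4, 0xbcd09152, 0xe0833b97, 0x7ae95dc1,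
   0xdfd82e94, 0x454db7c2, 0x1911ed07, 0x8c8474a1, 0x358acef3, 0x90df6759, 0xa31c5d9a, 0xf94604cf,
   0xe028e454, 0x79be7202, 0xd3e4d737, 0x45724191, 0x894a5b64, 0xdc2f0d32, 0x107c38f7, 0x4a169e51],
  [0x34433448, 0x9229922d, 0xa77aa771, 0xf11ff114, 0xb5883b83, 0xd0ee9dd9, 0x8344a81a, 0xe922fe4f,
   0x23b790c3, 0xb9d1c969, 0xea8b035a, 0x7feda50f, 0xf6948e44, 0x53c2d722, 0x9f071d77, 0xc5a14411,
   0xfbe030f4, 0x5d799a52, 0x98d3a697, 0xce45f3c1, 0x7209ecf3, 0x1b9c7659, 0xbe30d59a, 0xd75a40cf,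
   0xe85c1423, 0x7d0682b9, 0xd13527ea, 0x4490b17f, 0x090885c4, 0x9caee062, 0x30644357, 0x5a322901],
  [0x33343340, 0x99929929, 0xaaa7aa73, 0xfff1ff15, 0x37ab5883, 0x91fd0ed9, 0xabc8341a, 0xfd6e924f,
   0x96e090f4, 0xc37ac952, 0x0fd60397, 0xa543a5c1, 0x61e20e24, 0x387b97b2, 0xf2de3de7, 0x5b475471,
   0xc8a057c3, 0x6ef90169, 0x54c33b5a, 0x02659d0f, 0x698d99d4, 0x3cd4cc42, 0xf0110017, 0x5a48aa81,
   0x98ef6104, 0xcd7538a2, 0x01d9f267, 0xa44c5b31, 0x8e1b1e44, 0xd78d8722, 0x1d282d77, 0x44beb411]]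

/-- The bit mask of the `i`-th row of the `n`-th matrix. -/
def rowMask (n : Fin 5) (i : Fin 32) : ℕ := (rowList n).getD i 0

/-- The bit mask of the `x`-th column of the `n`-th matrix: by skewness it is the complement of
the mask of the `x`-th row, except at the diagonal entry. -/
def colMask (n : Fin 5) (x : Fin 32) : ℕ := rowMask n x ^^^ (0xffffffff - 2 ^ (x : ℕ))

/-- The five skew Hadamard matrices. -/
def hadamard (n : Fin 5) : Matrix (Fin 32) (Fin 32) ℤ := signMatrix (rowMask n)

theorem unitSkew_hadamard (n : Fin 5) : UnitSkew (hadamard n) := by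
  have h : ∀ (n : Fin 5) (p : Fin 3) (i j : Fin 32),
      hadamard n i (unitPerm p j) * unitSign p j + hadamard n j (unitPerm p i) * unitSign p i =
        if i = j then 2 else 0 := by
    decide +kernel
  exact h n

theorem sum_hadamard_mul_hadamard (n : Fin 5) (i j : Fin 32) :
    ∑ x, hadamard n i x * hadamard n j x = if i = j then 32 else 0 := by
  revert n i j
  decide +kernel

theorem isSkewHadamard_hadamard (n : Fin 5) : IsSkewHadamard (hadamard n) where
  entry i j := by
    unfold hadamard signMatrix
    split_ifs <;> simp
  skew i j := by
    have h := unitSkew_hadamard n 0 i j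
    simpa [unitPerm, unitSign] using h
  orth := by
    ext i j
    rw [Matrix.mul_apply, Matrix.smul_apply, Matrix.one_apply, smul_eq_mul, mul_ite, mul_one,
      mul_zero]
    exact sum_hadamard_mul_hadamard n i j

theorem hadamard_eq_transpose (n : Fin 5) : hadamard n = (signMatrix (colMask n))ᵀ := by
  have h : ∀ (n : Fin 5) (i x : Fin 32), (rowMask n i).testBit x = (colMask n x).testBit i := by
    decide +kernel
  ext i x
  rw [transpose_apply, hadamard, signMatrix, signMatrix, h]

theorem countConstant_rowMask (n : Fin 5) :
    countConstant 4 (List.ofFn (rowMask n)) 0 = ![0, 3, 5, 11, 22] n := by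
  have h : ∀ n : Fin 5, List.ofFn (rowMask n) = rowList n := by decide +kernel
  rw [h]
  revert n
  decide +kernel

theorem countConstant_colMask (n : Fin 5) : countConstant 4 (List.ofFn (colMask n)) 0 = 0 := by
  revert n
  decide +kernel

theorem card_fourSets_hadamard_transpose (n : Fin 5) :
    #(fourSets (hadamard n)ᵀ) = ![0, 3, 5, 11, 22] n := by
  have h : ∀ (n : Fin 5) (i : Fin 32), rowMask n i < 2 ^ 32 := by decide +kernel
  rw [hadamard, card_fourSets_transpose (h n), countConstant_rowMask]

theorem fourSets_hadamard (n : Fin 5) : fourSets (hadamard n) = ∅ := by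
  have h : ∀ (n : Fin 5) (i : Fin 32), colMask n i < 2 ^ 32 := by decide +kernel
  rw [← card_eq_zero, hadamard_eq_transpose, card_fourSets_transpose (h n), countConstant_colMask]

/-- For `2 ≤ k ≤ 10`, coefficients `t` for which the rows of the frame matrix have norm `16 k`. -/
theorem exists_coefficients {k : ℕ} (hk : 2 ≤ k) (hk' : k ≤ 10) : ∃ t : Fin 3 → ℤ,
    (2 : ℤ) ∣ ∑ p, t p ∧ 32 + 8 * ∑ p, t p + 16 * ∑ p, t p ^ 2 = 16 * k := by
  interval_cases k
  · exact ⟨![0, 0, 0], by decide, by decide⟩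
  · exact ⟨![0, -1, -1], by decide, by decide⟩
  · exact ⟨![0, 1, -1], by decide, by decide⟩
  · exact ⟨![0, 1, 1], by decide, by decide⟩
  · exact ⟨![-2, -1, -1], by decide, by decide⟩
  · exact ⟨![-2, 1, -1], by decide, by decide⟩
  · exact ⟨![2, -1, -1], by decide, by decide⟩
  · exact ⟨![2, 1, -1], by decide, by decide⟩
  · exact ⟨![2, 1, 1], by decide, by decide⟩

end SkewHadamard

open SkewHadamard in
theorem mainTheorem6 (k : ℕ) (hk : 2 ≤ k) (hk' : k ≤ 10) :
    ∃ C : Fin 5 → ModularCode.Code (2 * k) 32,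
      (∀ i, ModularCode.IsExtremalTypeII (C i)) ∧
      (∀ i j, i ≠ j → ¬ ModularCode.Equivalent (C i) (C j)) ∧
      (∀ i j, i ≠ j →
        ¬ ModularCode.Equivalent
          (ModularCode.binaryPart (C i)) (ModularCode.binaryPart (C j))) := by
  obtain ⟨t, ht, htk⟩ := exists_coefficients hk hk'
  have hk0 : k ≠ 0 := by omega
  have hH := isSkewHadamard_hadamard
  have hF : ∀ n, IsFrame k (hadamard n) (frameMatrix (hadamard n) t) := fun n =>
    isFrame_frameMatrix (hH n) (unitSkew_hadamard n) ht htk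
  have hpart : ∀ i j, i ≠ j → ¬ ModularCode.Equivalent
      (ModularCode.binaryPart (frameCode k (hadamard i) (frameMatrix (hadamard i) t)))
      (ModularCode.binaryPart (frameCode k (hadamard j) (frameMatrix (hadamard j) t))) := by
    intro i j hij h
    have h1 := card_fourWords_eq h
    rw [(hF i).card_fourWords (hH i) hk0, (hF j).card_fourWords (hH j) hk0,
      card_fourSets_hadamard_transpose, card_fourSets_hadamard_transpose] at h1
    have hinj : ∀ i j : Fin 5, (![0, 3, 5, 11, 22] : Fin 5 → ℕ) j = ![0, 3, 5, 11, 22] i →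
        i = j := by
      decide
    exact hij (hinj i j h1)
  exact ⟨fun n => frameCode k (hadamard n) (frameMatrix (hadamard n) t),
    fun n => (hF n).isExtremalTypeII (hH n) (fourSets_hadamard n) hk0,
    fun i j hij h => hpart i j hij (equivalent_binaryPart h), hpart⟩
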